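/- Let $\mathcal A_1=\prod_{p}(\mathbb Z/p\mathbb Z)\big/\bigoplus_{p}(\mathbb Z/p\mathbb Z)$, with $p$ running over all primes. It is a $\mathbb Q$-algebra through the diagonal embedding of $\mathbb Q$, and an element of it is given by its components at all but finitely many $p$. For positive integers $s_1,\dots,s_d$ (depth $d$, weight $s_1+\cdots+s_d$) put $$\zeta_{\mathcal A_1}(s_1,\dots,s_d)=\Big(\sum_{p>k_1>\cdots>k_d\ge 1}\frac1{k_1^{s_1}\cdots k_d^{s_d}}\bmod p\Big)_p,\qquad \zeta^\star_{\mathcal A_1}(s_1,\dots,s_d)=\Big(\sum_{p>k_1\ge\cdots\ge k_d\ge 1}\frac1{k_1^{s_1}\cdots k_d^{s_d}}\bmod p\Big)_p,$$ and let $\mathfrak b_7=\big(B_{p-7}/7 \bmod p\big)_{p>7}\in\mathcal A_1$, where $B_n$ are the Bernoulli numbers. Put $\mathfrak b_7'=\frac{7}{16}\mathfrak b_7=\big(B_{p-7}/16\bmod p\big)_{p>7}$. Then $$\begin{array}{lll} \zeta_{\mathcal A_1}(1,1,1,4)=-27\,\mathfrak b_7', & \zeta_{\mathcal A_1}(1,1,2,3)=69\,\mathfrak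 b_7', & \zeta_{\mathcal A_1}(1,1,3,2)=-27\,\mathfrak b_7',\\ \zeta_{\mathcal A_1}(1,1,4,1)=33\,\mathfrak b_7', & \zeta_{\mathcal A_1}(1,2,1,3)=-27\,\mathfrak b_7', & \zeta_{\mathcal A_1}(1,2,2,2)=-27\,\mathfrak b_7',\\ \zeta_{\mathcal A_1}(1,2,3,1)=-63\,\mathfrak b_7', & \zeta_{\mathcal A_1}(1,3,1,2)=-9\,\mathfrak b_7', & \zeta_{\mathcal A_1}(2,1,1,3)=33\,\mathfrak b_7',\\ \zeta_{\mathcal A_1}(2,1,2,2)=-63\,\mathfrak b_7'. & & \end{array}$$ All the other values $\zeta_{\mathcal A_1}(s_1,s_2,s_3,s_4)$ of depth $4$ and weight $7$ follow from these by the reversal relation $\zeta_{\mathcal A_1}(s_4,s_3,s_2,s_1)=-\zeta_{\mathcal A_1}(s_1,s_2,s_3,s_4)$; in particular every such value is a rational multiple of $\mathfrak b_7$. Moreover, $\zeta^\star_{\mathcal A_1}(s_1,s_2,s_3,s_4)=\zeta_{\mathcal A_1}(s_1,s_2,s_3,s_4)$ for all positive integers $s_1,\dots,s_4$ with sum $7$.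 -/

import Mathlib

/-- The ideal `⨁ₚ ℤ/pℤ` of the ring `∏ₚ ℤ/pℤ`: families that vanish at all but finitely
many primes. -/
def FMZV.finSupp : Ideal (∀ p : Nat.Primes, ZMod p) where
  carrier := {a | {p | a p ≠ 0}.Finite}
  zero_mem' := by simp
  add_mem' := by
    intro a b ha hb
    refine (Set.Finite.union ha hb).subset ?_
    intro p hp
    by_contra h
    simp only [Set.mem_union, Set.mem_setOf_eq, not_or, not_not] at h
    exact hp (by simp [h.1, h.2])
  smul_mem' := by
    intro c a ha
    refine Set.Finite.subset ha ?_
    intro p hp h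
    exact hp (by simp [h])

/-- The ring `𝒜₁ = (∏ₚ ℤ/pℤ) / (⨁ₚ ℤ/pℤ)`, products and sums over all primes. -/
def FMZV.A₁ : Type := (∀ p : Nat.Primes, ZMod p) ⧸ FMZV.finSupp

noncomputable instance FMZV.instCommRingA₁ : CommRing FMZV.A₁ :=
  inferInstanceAs (CommRing ((∀ p : Nat.Primes, ZMod p) ⧸ FMZV.finSupp))

/-- The class in `𝒜₁` of a family `(aₚ)ₚ`. -/
noncomputable def FMZV.mk : (∀ p : Nat.Primes, ZMod p) →+* FMZV.A₁ :=
  Ideal.Quotient.mk FMZV.finSupp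

/-- Two families have the same class iff they agree at all but finitely many primes. -/
theorem FMZV.mk_eq_mk_iff (a b : ∀ p : Nat.Primes, ZMod p) :
    FMZV.mk a = FMZV.mk b ↔ {p | a p ≠ b p}.Finite := by
  have h : FMZV.mk a = FMZV.mk b ↔ a - b ∈ FMZV.finSupp := Ideal.Quotient.eq
  have h2 : a - b ∈ FMZV.finSupp ↔ {p | (a - b) p ≠ 0}.Finite := Iff.rfl
  rw [h, h2]
  simp only [Pi.sub_apply, ne_eq, sub_eq_zero]

/-- Reduction of a rational number modulo `p`: it is `0` if `p` divides the denominator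
(because `ZMod.inv` is `0` at `0`) and the usual reduction otherwise. -/
def FMZV.ratMod (r : ℚ) (p : Nat.Primes) : ZMod p :=
  (r.num : ZMod p) * (r.den : ZMod p)⁻¹

theorem FMZV.ratMod_eq_zero_of_dvd (r : ℚ) (p : Nat.Primes) (h : (p : ℕ) ∣ r.den) :
    FMZV.ratMod r p = 0 := by
  rw [FMZV.ratMod, (ZMod.natCast_eq_zero_iff _ _).2 h, ZMod.inv_zero, mul_zero]

theorem FMZV.ratMod_eq_cast (r : ℚ) (p : Nat.Primes) [Fact (p : ℕ).Prime] :
    FMZV.ratMod r p = (r : ZMod p) := by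
  rw [FMZV.ratMod, Rat.cast_def, div_eq_mul_inv]

theorem FMZV.finite_dvd (n : ℕ) (hn : n ≠ 0) :
    {p : Nat.Primes | ((n : ℕ) : ZMod p) = 0}.Finite := by
  refine Set.Finite.of_finite_image (f := fun p : Nat.Primes => (p : ℕ)) ?_
    Nat.Primes.coe_nat_injective.injOn
  refine (Set.finite_Iic n).subset ?_
  rintro _ ⟨p, hp, rfl⟩
  exact Nat.le_of_dvd (Nat.pos_of_ne_zero hn) ((ZMod.natCast_eq_zero_iff _ _).1 hp)

/-- The diagonal embedding `ℚ → 𝒜₁`. -/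
noncomputable def FMZV.iota : ℚ →+* FMZV.A₁ where
  toFun r := FMZV.mk (FMZV.ratMod r)
  map_one' := by
    rw [← map_one FMZV.mk]
    congr 1
    funext p
    simp [FMZV.ratMod]
  map_zero' := by
    rw [← map_zero FMZV.mk]
    congr 1
    funext p
    simp [FMZV.ratMod]
  map_add' r s := by
    rw [← map_add, FMZV.mk_eq_mk_iff]
    refine ((FMZV.finite_dvd r.den r.den_nz).union (FMZV.finite_dvd s.den s.den_nz)).subset ?_
    intro p hp
    by_contra h
    simp only [Set.mem_union, Set.mem_setOf_eq, not_or] at h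
    haveI : Fact (p : ℕ).Prime := ⟨p.2⟩
    refine hp ?_
    rw [Pi.add_apply, FMZV.ratMod_eq_cast, FMZV.ratMod_eq_cast, FMZV.ratMod_eq_cast,
      Rat.cast_add_of_ne_zero h.1 h.2]
  map_mul' r s := by
    rw [← map_mul, FMZV.mk_eq_mk_iff]
    refine ((FMZV.finite_dvd r.den r.den_nz).union (FMZV.finite_dvd s.den s.den_nz)).subset ?_
    intro p hp
    by_contra h
    simp only [Set.mem_union, Set.mem_setOf_eq, not_or] at h
    haveI : Fact (p : ℕ).Prime := ⟨p.2⟩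
    refine hp ?_
    rw [Pi.mul_apply, FMZV.ratMod_eq_cast, FMZV.ratMod_eq_cast, FMZV.ratMod_eq_cast,
      Rat.cast_mul_of_ne_zero h.1 h.2]

/-- `𝒜₁` is a `ℚ`-algebra through the diagonal embedding. -/
noncomputable instance FMZV.instAlgebraA₁ : Algebra ℚ FMZV.A₁ := FMZV.iota.toAlgebra

/-- The multiple harmonic sum `∑_{p > k₁ > ⋯ > k_d ≥ 1} 1 / (k₁^{s₁} ⋯ k_d^{s_d})` modulo `p`. -/
def FMZV.harmonicSum {d : ℕ} (s : Fin d → ℕ) (p : Nat.Primes) : ZMod p :=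
  ∑ k ∈ (Fintype.piFinset fun _ : Fin d => Finset.Ico 1 (p : ℕ)) with
      ∀ i j : Fin d, i < j → k j < k i,
    ∏ j : Fin d, ((k j : ZMod p) ^ s j)⁻¹

/-- The star sum `∑_{p > k₁ ≥ ⋯ ≥ k_d ≥ 1} 1 / (k₁^{s₁} ⋯ k_d^{s_d})` modulo `p`. -/
def FMZV.harmonicSumStar {d : ℕ} (s : Fin d → ℕ) (p : Nat.Primes) : ZMod p :=
  ∑ k ∈ (Fintype.piFinset fun _ : Fin d => Finset.Ico 1 (p : ℕ)) with
      ∀ i j : Fin d, i < j → k j ≤ k i,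
    ∏ j : Fin d, ((k j : ZMod p) ^ s j)⁻¹

/-- The finite multiple zeta value `ζ_{𝒜₁}(s₁, …, s_d)`. -/
noncomputable def FMZV.zeta {d : ℕ} (s : Fin d → ℕ) : FMZV.A₁ :=
  FMZV.mk (FMZV.harmonicSum s)

/-- The finite multiple zeta star value `ζ⋆_{𝒜₁}(s₁, …, s_d)`. -/
noncomputable def FMZV.zetaStar {d : ℕ} (s : Fin d → ℕ) : FMZV.A₁ :=
  FMZV.mk (FMZV.harmonicSumStar s)

/-- The `𝒜₁`-Bernoulli number `b_k = (B_{p-k} / k mod p)_{p > k}`, for `k ≥ 1`; the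
components at the primes `p ≤ k` are `0`. -/
noncomputable def FMZV.b (k : ℕ) : FMZV.A₁ :=
  FMZV.mk fun p => if k < (p : ℕ) then FMZV.ratMod (bernoulli ((p : ℕ) - k) / k) p else 0

/-! Three families of linear relations, together with one explicit value, determine all values of
weight 7 and depth 2, 3 and 4.

Reversal comes from k ↦ p - k. In odd weight its sign is -1, so it halves the unknowns and kills
palindromes. The quasi-shuffle product with a depth-one value gives relations with zero right-hand
side, since depth-one sums vanish modulo p (`sum_stuffleInsert`).

The shuffle relation (`sum_shuffle`) comes from multiple polylogarithms. The product of two of them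
is the sum over the shuffles of their words, and comparing coefficients of z^n modulo p is
legitimate for n < p, where n is invertible. Summing these coefficients over n < p gives the
shuffled harmonic sums. The same quantity is a convolution over x + y = p; there y ≡ -x, so the
exponents of the second index move one by one to the first, in reverse order and with a sign
(`conv_nestedTerm`).

The explicit value is ζ(1,6) = -7 b₇ (`zetaList_one_left`), obtained from Faulhaber's formula and
Fermat's little theorem. What remains is linear algebra over ℚ: first depths 2 and 3, then depth 4.
Star values expand into values of merged indices, and the tables show that the terms of lower depth
cancel. -/

namespace FMZV

open Finset

/-! ### Cauchy products and partial sums. -/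

section Sequences

variable {R : Type*} [CommRing R]

/-- The Cauchy product of two sequences. -/
def conv (f g : ℕ → R) (n : ℕ) : R := ∑ x ∈ antidiagonal n, f x.1 * g x.2

/-- The sequence of partial sums `∑_{m < n} f m`. -/
def psum (f : ℕ → R) (n : ℕ) : R := ∑ m ∈ range n, f m

theorem conv_comm (f g : ℕ → R) (n : ℕ) : conv f g n = conv g f n := by
  rw [conv, conv, ← Finset.Nat.sum_antidiagonal_swap]
  exact sum_congr rfl fun x _ => mul_comm _ _

theorem psum_succ (f : ℕ → R) (n : ℕ) : psum f (n + 1) = psum f n + f n := sum_range_succ _ _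

@[simp] theorem psum_zero (f : ℕ → R) : psum f 0 = 0 := sum_range_zero _

/-- On generating series `psum` is multiplication by z / (1 - z), so this is associativity of
multiplication. -/
theorem conv_psum_left (f g : ℕ → R) (n : ℕ) : conv (psum f) g n = psum (conv f g) n := by
  induction n with
  | zero => simp [conv]
  | succ n ih =>
    rw [psum_succ, ← ih, conv, Finset.Nat.sum_antidiagonal_succ]
    simp only [psum_succ, psum_zero, zero_mul, zero_add, add_mul, sum_add_distrib]
    rfl

theorem conv_psum_right (f g : ℕ → R) (n : ℕ) : conv f (psum g) n = psum (conv f g) n := by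
  rw [conv_comm, conv_psum_left]
  exact sum_congr rfl fun m _ => conv_comm _ _ _

/-- The sequence `1, 0, 0, …`, the unit for the Cauchy product. -/
def unitSeq (n : ℕ) : R := if n = 0 then 1 else 0

theorem conv_unitSeq_right (f : ℕ → R) (n : ℕ) : conv f unitSeq n = f n := by
  rw [conv, sum_eq_single (n, 0)]
  · simp [unitSeq]
  · rintro ⟨i, j⟩ hij hne
    have : j ≠ 0 := by
      rintro rfl
      exact hne (by simpa using hij)
    simp [unitSeq, this]
  · intro h
    simp at h

theorem conv_unitSeq_left (f : ℕ → R) (n : ℕ) : conv unitSeq f n = f n := by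
  rw [conv_comm, conv_unitSeq_right]

end Sequences

/-! ### Shuffle product of multiple polylogarithms modulo p. -/

section Shuffle

/-- All shuffles, with multiplicity, of two words. -/
def shuffle {α : Type*} : List α → List α → List (List α)
  | [], v => [v]
  | u, [] => [u]
  | a :: u, b :: v =>
    (shuffle u (b :: v)).map (a :: ·) ++ (shuffle (a :: u) v).map (b :: ·)
  termination_by u v => u.length + v.length

theorem shuffle_nil_left {α : Type*} (v : List α) : shuffle [] v = [v] := by
  rw [shuffle]

theorem shuffle_nil_right {α : Type*} (u : List α) : shuffle u [] = [u] := by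
  cases u <;> simp [shuffle]

theorem shuffle_cons_cons {α : Type*} (a b : α) (u v : List α) :
    shuffle (a :: u) (b :: v) =
      (shuffle u (b :: v)).map (a :: ·) ++ (shuffle (a :: u) v).map (b :: ·) := by
  rw [shuffle]

variable (p : ℕ)

/-- The operator `f ↦ (1 / n) ∑_{m < n} f m` (letter `true`) or `f ↦ f n / n` (letter `false`)
on sequences modulo `p`: termwise integration against `dz / (1 - z)` or `dz / z`. -/
def letterOp (a : Bool) (f : ℕ → ZMod p) (n : ℕ) : ZMod p :=
  (n : ZMod p)⁻¹ * if a then psum f n else f n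

/-- The coefficients modulo `p` of the multiple polylogarithm of a word. -/
def wordCoeff : List Bool → ℕ → ZMod p
  | [] => unitSeq
  | a :: w => letterOp p a (wordCoeff w)

/-- A word is admissible if it is empty or ends in the letter `true`. -/
def Admissible : List Bool → Prop
  | [] => True
  | true :: w => Admissible w
  | false :: w => w ≠ [] ∧ Admissible w

theorem Admissible.tail {a : Bool} {w : List Bool} (h : Admissible (a :: w)) : Admissible w := by
  cases a
  · exact h.2
  · exact h

theorem ne_nil_of_mem_shuffle {α : Type*} {a : α} {u v w : List α}
    (hw : w ∈ shuffle (a :: u) v ∨ w ∈ shuffle v (a :: u)) : w ≠ [] := by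
  cases v with
  | nil =>
    rw [shuffle_nil_left, shuffle_nil_right, or_self, List.mem_singleton] at hw
    simp [hw]
  | cons b v =>
    rintro rfl
    simp [shuffle_cons_cons] at hw

theorem admissible_of_mem_shuffle {u v : List Bool} (hu : Admissible u) (hv : Admissible v) :
    ∀ w ∈ shuffle u v, Admissible w := by
  induction u, v using shuffle.induct with
  | case1 v => simpa [shuffle_nil_left] using hv
  | case2 u => simpa [shuffle_nil_right] using hu
  | case3 a u b v ih₁ ih₂ =>
    intro w hw
    rw [shuffle_cons_cons, List.mem_append, List.mem_map, List.mem_map] at hw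
    rcases hw with ⟨w, hw, rfl⟩ | ⟨w, hw, rfl⟩
    · have := ih₁ hu.tail hv w hw
      cases a
      · exact ⟨ne_nil_of_mem_shuffle (Or.inr hw), this⟩
      · exact this
    · have := ih₂ hu hv.tail w hw
      cases b
      · exact ⟨ne_nil_of_mem_shuffle (Or.inl hw), this⟩
      · exact this

theorem wordCoeff_zero {w : List Bool} (hw : w ≠ []) : wordCoeff p w 0 = 0 := by
  cases w with
  | nil => exact absurd rfl hw
  | cons a w => simp [wordCoeff, letterOp, ZMod.inv_zero]

theorem sum_map_wordCoeff_cons (a : Bool) (L : List (List Bool)) (n : ℕ) :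
    ((L.map (a :: ·)).map (wordCoeff p · n)).sum =
      letterOp p a (fun m => (L.map (wordCoeff p · m)).sum) n := by
  induction L with
  | nil => simp [letterOp, psum]
  | cons w L ih =>
    simp only [List.map_cons, List.sum_cons, ih]
    cases a <;> simp [wordCoeff, letterOp, psum, sum_add_distrib, mul_add]

/-- Coefficients up to n suffice, so an induction can stay within the range n < p. -/
theorem letterOp_congr {a : Bool} {f g : ℕ → ZMod p} {n : ℕ} (h : ∀ m ≤ n, f m = g m) :
    letterOp p a f n = letterOp p a g n := by
  cases a
  · simp [letterOp, h n le_rfl]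
  · simp only [letterOp, if_true, psum]
    rw [sum_congr rfl fun m hm => h m (mem_range.1 hm).le]

theorem conv_letter (a : Bool) (f g : ℕ → ZMod p) (n : ℕ) :
    conv (fun m => if a then psum f m else f m) g n =
      if a then psum (conv f g) n else conv f g n := by
  cases a
  · rfl
  · exact conv_psum_left f g n

variable [Fact p.Prime]

theorem natCast_ne_zero_of_lt {n : ℕ} (h₀ : n ≠ 0) (hn : n < p) : (n : ZMod p) ≠ 0 := fun h =>
  absurd (Nat.le_of_dvd (Nat.pos_of_ne_zero h₀) ((ZMod.natCast_eq_zero_iff _ _).1 h)) (by omega)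

/-- This is differentiation z d/dz undoing the integration. At n = 0 the inverse is 0 by default, so
a constant term would be lost: `psum` has none, and for the letter `false` it must be excluded. This
is where admissibility enters. -/
theorem natCast_mul_letterOp {a : Bool} {f : ℕ → ZMod p} (hf : a = false → f 0 = 0) {n : ℕ}
    (hn : n < p) : (n : ZMod p) * letterOp p a f n = if a then psum f n else f n := by
  rcases eq_or_ne n 0 with rfl | h₀
  · cases a
    · simp [hf rfl]
    · simp
  · rw [letterOp, mul_inv_cancel_left₀ (natCast_ne_zero_of_lt p h₀ hn)]

/-- The Leibniz rule for z d/dz: in the convolution, n = x.1 + x.2, and each summand cancels the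
division in one factor. Dividing by n afterwards requires 0 < n < p. -/
theorem conv_letterOp {a b : Bool} {f g : ℕ → ZMod p} (hf : a = false → f 0 = 0)
    (hg : b = false → g 0 = 0) {n : ℕ} (hn : n < p) :
    conv (letterOp p a f) (letterOp p b g) n =
      letterOp p a (conv f (letterOp p b g)) n + letterOp p b (conv (letterOp p a f) g) n := by
  rcases eq_or_ne n 0 with rfl | h₀
  · simp [conv, letterOp]
  have hn0 := natCast_ne_zero_of_lt p h₀ hn
  have key : (n : ZMod p) * conv (letterOp p a f) (letterOp p b g) n =
      (if a then psum (conv f (letterOp p b g)) n else conv f (letterOp p b g) n) +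
      (if b then psum (conv (letterOp p a f) g) n else conv (letterOp p a f) g n) := by
    have h₂ : (if b then psum (conv (letterOp p a f) g) n else conv (letterOp p a f) g n) =
        conv (letterOp p a f) (fun m => if b then psum g m else g m) n := by
      cases b
      · rfl
      · exact (conv_psum_right _ _ _).symm
    rw [← conv_letter, h₂, conv, conv, conv, mul_sum, ← sum_add_distrib]
    refine sum_congr rfl fun x hx => ?_
    have hx' := mem_antidiagonal.1 hx
    rw [← natCast_mul_letterOp p hf (show x.1 < p by omega),
      ← natCast_mul_letterOp p hg (show x.2 < p by omega), ← hx']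
    push_cast
    ring
  rw [letterOp, letterOp, ← mul_add, ← key, inv_mul_cancel_left₀ hn0]

/-- The shuffle product formula for the coefficients of multiple polylogarithms. -/
theorem conv_wordCoeff {u v : List Bool} (hu : Admissible u) (hv : Admissible v) {n : ℕ}
    (hn : n < p) :
    conv (wordCoeff p u) (wordCoeff p v) n = ((shuffle u v).map (wordCoeff p · n)).sum := by
  induction u, v using shuffle.induct generalizing n with
  | case1 v => simp [shuffle_nil_left, wordCoeff, conv_unitSeq_left]
  | case2 u => simp [shuffle_nil_right, wordCoeff, conv_unitSeq_right]
  | case3 a u b v ih₁ ih₂ =>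
    rw [shuffle_cons_cons, List.map_append, List.sum_append, sum_map_wordCoeff_cons,
      sum_map_wordCoeff_cons, wordCoeff, wordCoeff, conv_letterOp p _ _ hn]
    · congr 1
      · exact letterOp_congr p fun m hm => ih₁ hu.tail hv (by omega)
      · exact letterOp_congr p fun m hm => ih₂ hu hv.tail (by omega)
    · rintro rfl
      exact wordCoeff_zero p hu.1
    · rintro rfl
      exact wordCoeff_zero p hv.1

end Shuffle

/-! ### Multiple harmonic sums: shuffle, reversal and quasi-shuffle relations. -/

section Nested

variable (p : ℕ)

/-- The operator `f ↦ (n^{-a} ∑_{m < n} f m)_n` on sequences modulo `p`. -/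
def indexOp (a : ℕ) (f : ℕ → ZMod p) (n : ℕ) : ZMod p := ((n : ZMod p) ^ a)⁻¹ * psum f n

/-- The terms `k₁^{-s₁} ∑_{k₁ > k₂ > ⋯ > k_d ≥ 1} 1 / (k₂^{s₂} ⋯ k_d^{s_d})` modulo `p`. -/
def nestedTerm : List ℕ → ℕ → ZMod p
  | [] => unitSeq
  | a :: s => indexOp p a (nestedTerm s)

/-- The sum `∑_{n > k₁ > ⋯ > k_d ≥ 1} 1 / (k₁^{s₁} ⋯ k_d^{s_d})` modulo `p`, for `n ≥ 1`. -/
def nestedSum (s : List ℕ) (n : ℕ) : ZMod p := psum (nestedTerm p s) n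

@[simp] theorem nestedSum_zero (s : List ℕ) : nestedSum p s 0 = 0 := psum_zero _

theorem nestedSum_cons (a : ℕ) (s : List ℕ) (n : ℕ) :
    nestedSum p (a :: s) n = ∑ k ∈ range n, ((k : ZMod p) ^ a)⁻¹ * nestedSum p s k := rfl

theorem nestedSum_cons_succ (a : ℕ) (s : List ℕ) (n : ℕ) :
    nestedSum p (a :: s) (n + 1) =
      nestedSum p (a :: s) n + ((n : ZMod p) ^ a)⁻¹ * nestedSum p s n := sum_range_succ _ _

theorem nestedSum_nil {n : ℕ} (hn : n ≠ 0) : nestedSum p [] n = 1 := by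
  simp [nestedSum, psum, nestedTerm, unitSeq, Nat.pos_of_ne_zero hn]

theorem nestedSum_mul_nil (s : List ℕ) (n : ℕ) :
    nestedSum p s n * nestedSum p [] n = nestedSum p s n := by
  rcases eq_or_ne n 0 with rfl | h
  · simp
  · rw [nestedSum_nil p h, mul_one]

/-- The word `x^{s₁ - 1} y ⋯ x^{s_d - 1} y` of an index, with `x = false` and `y = true`. -/
def indexWord : List ℕ → List Bool
  | [] => []
  | a :: s => List.replicate (a - 1) false ++ true :: indexWord s

/-- The index of an admissible word. -/
def wordIndex : List Bool → List ℕ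
  | [] => []
  | true :: w => 1 :: wordIndex w
  | false :: w => (wordIndex w).modifyHead (· + 1)

theorem admissible_replicate_append {w : List Bool} (hw : w ≠ []) (h : Admissible w) (k : ℕ) :
    Admissible (List.replicate k false ++ w) := by
  induction k with
  | zero => exact h
  | succ k ih => exact ⟨by simp [hw], ih⟩

theorem admissible_indexWord (s : List ℕ) : Admissible (indexWord s) := by
  induction s with
  | nil => trivial
  | cons a s ih => exact admissible_replicate_append (List.cons_ne_nil true _) ih _

variable [Fact p.Prime]

theorem wordCoeff_wordIndex {w : List Bool} (hw : Admissible w) :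
    wordCoeff p w = nestedTerm p (wordIndex w) := by
  induction w with
  | nil => rfl
  | cons a w ih =>
    funext n
    cases a
    -- Admissibility guarantees a head entry for the letter `false` to raise; on an empty index
    -- `modifyHead` would do nothing.
    · have hne : wordIndex w ≠ [] := by
        obtain ⟨h₁, h₂⟩ := hw
        clear ih
        induction w with
        | nil => exact absurd rfl h₁
        | cons b w ih =>
          cases b
          · simpa [wordIndex] using ih h₂.1 h₂.2
          · simp [wordIndex]
      obtain ⟨b, s, hs⟩ := List.exists_cons_of_ne_nil hne
      simp [wordIndex, wordCoeff, letterOp, ih hw.tail, hs, nestedTerm, indexOp, pow_succ]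
      ring
    · simp [wordIndex, wordCoeff, letterOp, ih hw.tail, nestedTerm, indexOp]

theorem wordIndex_indexWord {s : List ℕ} (hs : ∀ a ∈ s, 1 ≤ a) : wordIndex (indexWord s) = s := by
  induction s with
  | nil => rfl
  | cons a s ih =>
    obtain ⟨a, rfl⟩ : ∃ b, a = b + 1 := ⟨a - 1, by have := hs a (by simp); omega⟩
    have := ih fun b hb => hs b (by simp [hb])
    have key : ∀ k : ℕ, wordIndex (List.replicate k false ++ true :: indexWord s) =
        (k + 1) :: s := by
      intro k
      induction k with
      | zero => simp [wordIndex, this]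
      | succ k ih => simp [List.replicate_succ, wordIndex, ih]
    simpa [indexWord] using key a

/-- The partial sum passes from one factor to the other, and on x + y = p one has y ≡ -x, so the
factor y^{-a} becomes (-1)^a x^{-a}. The default inverse of 0 respects this, so the end terms need
no separate treatment. -/
theorem conv_psum_indexOp (a : ℕ) (f g : ℕ → ZMod p) :
    conv f (psum (indexOp p a g)) p = (-1) ^ a * conv (indexOp p a f) (psum g) p := by
  rw [conv_psum_right, ← conv_psum_left, conv, conv, mul_sum]
  refine sum_congr rfl fun x hx => ?_
  have h : (x.1 : ZMod p) + x.2 = 0 := by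
    rw [← Nat.cast_add, mem_antidiagonal.1 hx, ZMod.natCast_self]
  have h' : (x.2 : ZMod p) = -1 * x.1 := by linear_combination h
  rw [indexOp, indexOp, h', mul_pow, mul_inv, ← inv_pow (-1 : ZMod p), inv_neg_one]
  ring

/-- Each application of `conv_psum_indexOp` moves the leading entry of `t` to the front of `s`,
which reverses `t`. -/
theorem conv_nestedTerm (s t : List ℕ) :
    conv (nestedTerm p s) (psum (nestedTerm p t)) p =
      (-1) ^ t.sum * nestedSum p (t.reverse ++ s) p := by
  induction t generalizing s with
  | nil =>
    rw [nestedTerm, conv_psum_right, List.sum_nil, pow_zero, one_mul]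
    exact sum_congr rfl fun m _ => conv_unitSeq_right _ _
  | cons a t ih =>
    rw [nestedTerm, conv_psum_indexOp, ← nestedTerm, ih, List.sum_cons, pow_add, mul_assoc,
      List.reverse_cons, List.append_assoc]
    rfl

/-- The shuffle relation for multiple harmonic sums modulo `p`. -/
theorem sum_shuffle_nestedSum {s t : List ℕ} (hs : ∀ a ∈ s, 1 ≤ a) (ht : ∀ a ∈ t, 1 ≤ a) :
    ((shuffle (indexWord s) (indexWord t)).map fun w => nestedSum p (wordIndex w) p).sum =
      (-1) ^ t.sum * nestedSum p (t.reverse ++ s) p := by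
  have hadm := admissible_of_mem_shuffle (admissible_indexWord s) (admissible_indexWord t)
  rw [← conv_nestedTerm, conv_psum_right, psum]
  calc _ = ((shuffle (indexWord s) (indexWord t)).map
          fun w => ∑ n ∈ range p, wordCoeff p w n).sum := by
        congr 1
        refine List.map_congr_left fun w hw => ?_
        rw [wordCoeff_wordIndex p (hadm w hw)]
        rfl
    _ = ∑ n ∈ range p, ((shuffle (indexWord s) (indexWord t)).map (wordCoeff p · n)).sum := by
        generalize shuffle (indexWord s) (indexWord t) = L
        induction L with
        | nil => simp
        | cons w L ih => simp [ih, sum_add_distrib]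
    _ = _ := by
        refine sum_congr rfl fun n hn => ?_
        rw [← conv_wordCoeff p (admissible_indexWord s) (admissible_indexWord t) (mem_range.1 hn),
          wordCoeff_wordIndex p (admissible_indexWord s),
          wordCoeff_wordIndex p (admissible_indexWord t), wordIndex_indexWord hs,
          wordIndex_indexWord ht]

/-- The reversal relation for multiple harmonic sums modulo `p`. -/
theorem nestedSum_reverse (s : List ℕ) :
    nestedSum p s p = (-1) ^ s.sum * nestedSum p s.reverse p := by
  -- With an empty first index the convolution is just the harmonic sum of `s`, and all its entries
  -- get moved.
  have h := conv_nestedTerm p [] s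
  rw [List.append_nil, nestedTerm, conv_unitSeq_left] at h
  exact h

/-- The terms of the quasi-shuffle product of the index `[a]` with another index. -/
def stuffleInsert (a : ℕ) : List ℕ → List (List ℕ)
  | [] => [[a]]
  | b :: s => (a :: b :: s) :: ((a + b) :: s) :: (stuffleInsert a s).map (b :: ·)

theorem nestedSum_sum_cons (b : ℕ) (L : List (List ℕ)) (n : ℕ) :
    ((L.map (b :: ·)).map (nestedSum p · n)).sum =
      ∑ k ∈ range n, ((k : ZMod p) ^ b)⁻¹ * (L.map (nestedSum p · k)).sum := by
  induction L with
  | nil => simp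
  | cons l L ih =>
    simp only [List.map_cons, List.sum_cons, ih, nestedSum_cons, mul_add, sum_add_distrib]

/-- The quasi-shuffle relation for products with a sum of depth one. -/
theorem nestedSum_singleton_mul (a : ℕ) (s : List ℕ) (n : ℕ) :
    nestedSum p [a] n * nestedSum p s n = ((stuffleInsert a s).map (nestedSum p · n)).sum := by
  induction s generalizing n with
  | nil => simp [stuffleInsert, nestedSum_mul_nil]
  | cons b s ih =>
    rw [stuffleInsert, List.map_cons, List.map_cons, List.sum_cons, List.sum_cons,
      nestedSum_sum_cons]
    induction n with
    | zero => simp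
    | succ n ihn =>
      -- The three new products correspond to the position of n: largest entry of `b :: s`, of
      -- `[a]`, or of both. The empty sum is 0 rather than 1 at n = 0; `h₁` and `h₂` absorb this.
      rw [sum_range_succ, ← ih, nestedSum_cons_succ, nestedSum_cons_succ, nestedSum_cons_succ,
        nestedSum_cons_succ, pow_add, mul_inv]
      have h₁ := nestedSum_mul_nil p (b :: s) n
      have h₂ := nestedSum_mul_nil p s n
      linear_combination ihn + ((n : ZMod p) ^ a)⁻¹ * h₁ +
        ((n : ZMod p) ^ a)⁻¹ * ((n : ZMod p) ^ b)⁻¹ * h₂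

end Nested

/-! ### Bernoulli numbers modulo p and harmonic sums of index (1, b). -/

section Bernoulli

variable (p : ℕ) [Fact p.Prime]

/-- The rational number `r` is `p`-integral with residue `x`. -/
def HasResidue (r : ℚ) (x : ZMod p) : Prop := (r.den : ZMod p) ≠ 0 ∧ (r : ZMod p) = x

variable {p}

theorem HasResidue.natCast (n : ℕ) : HasResidue p n n := by
  simp [HasResidue]

theorem HasResidue.intCast (n : ℤ) : HasResidue p n n := by
  simp [HasResidue]

theorem HasResidue.add {r s : ℚ} {x y : ZMod p} (hr : HasResidue p r x) (hs : HasResidue p s y) :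
    HasResidue p (r + s) (x + y) := by
  refine ⟨fun h => ?_, by rw [Rat.cast_add_of_ne_zero hr.1 hs.1, hr.2, hs.2]⟩
  have := (ZMod.natCast_eq_zero_iff _ _).2
    (((ZMod.natCast_eq_zero_iff _ _).1 h).trans (Rat.add_den_dvd r s))
  rw [Nat.cast_mul] at this
  exact (mul_ne_zero hr.1 hs.1) this

theorem HasResidue.mul {r s : ℚ} {x y : ZMod p} (hr : HasResidue p r x) (hs : HasResidue p s y) :
    HasResidue p (r * s) (x * y) := by
  refine ⟨fun h => ?_, by rw [Rat.cast_mul_of_ne_zero hr.1 hs.1, hr.2, hs.2]⟩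
  have := (ZMod.natCast_eq_zero_iff _ _).2
    (((ZMod.natCast_eq_zero_iff _ _).1 h).trans (Rat.mul_den_dvd r s))
  rw [Nat.cast_mul] at this
  exact (mul_ne_zero hr.1 hs.1) this

theorem HasResidue.pow {r : ℚ} {x : ZMod p} (hr : HasResidue p r x) (n : ℕ) :
    HasResidue p (r ^ n) (x ^ n) := by
  induction n with
  | zero => simpa using HasResidue.natCast (p := p) 1
  | succ n ih => simpa only [pow_succ] using ih.mul hr

theorem HasResidue.sum {ι : Type*} {s : Finset ι} {r : ι → ℚ} {x : ι → ZMod p}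
    (h : ∀ i ∈ s, HasResidue p (r i) (x i)) : HasResidue p (∑ i ∈ s, r i) (∑ i ∈ s, x i) := by
  classical
  induction s using Finset.induction_on with
  | empty => simpa using HasResidue.natCast (p := p) 0
  | insert i s hi ih =>
    rw [sum_insert hi, sum_insert hi]
    exact (h i (by simp)).add (ih fun j hj => h j (by simp [hj]))

theorem HasResidue.natCast_inv {n : ℕ} (hn : (n : ZMod p) ≠ 0) :
    HasResidue p (n : ℚ)⁻¹ (n : ZMod p)⁻¹ := by
  have h₀ : n ≠ 0 := by
    rintro rfl
    simp at hn
  refine ⟨?_, by simp⟩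
  rwa [Rat.inv_natCast_den, if_neg h₀]

/-- The Bernoulli numbers `B_i` with `i < p - 1` are `p`-integral. -/
theorem hasResidue_bernoulli {i : ℕ} (hi : i + 1 < p) :
    HasResidue p (bernoulli i) (bernoulli i : ZMod p) := by
  induction i using Nat.strong_induction_on with
  | _ i ih =>
    have h := sum_bernoulli (i + 1)
    rw [sum_range_succ, Nat.choose_succ_self_right] at h
    have hne : ((i + 1 : ℕ) : ZMod p) ≠ 0 := natCast_ne_zero_of_lt p (by omega) hi
    have hq : ((i + 1 : ℕ) : ℚ) ≠ 0 := by positivity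
    -- The recurrence solved for its last term: the only new denominator is i + 1, which is prime to
    -- p.
    have hb : bernoulli i = ((i + 1 : ℕ) : ℚ)⁻¹ * (((if i + 1 = 1 then 1 else 0 : ℕ) : ℚ) +
        ((-1 : ℤ) : ℚ) * ∑ k ∈ range i, ((i + 1).choose k : ℚ) * bernoulli k) := by
      rw [eq_inv_mul_iff_mul_eq₀ hq]
      push_cast at h ⊢
      linear_combination h
    have hr : HasResidue p (bernoulli i) _ := hb ▸
      (HasResidue.natCast_inv hne).mul ((HasResidue.natCast _).add ((HasResidue.intCast (-1)).mul
        (HasResidue.sum fun k hk => (HasResidue.natCast ((i + 1).choose k)).mul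
          (ih k (mem_range.1 hk) (by have := mem_range.1 hk; omega)))))
    exact ⟨hr.1, rfl⟩

/-- Faulhaber's formula modulo `p`. -/
theorem sum_range_pow_zmod {q : ℕ} (hq : q + 1 < p) (n : ℕ) :
    ((q : ZMod p) + 1) * ∑ k ∈ range n, (k : ZMod p) ^ q =
      ∑ i ∈ range (q + 1), (bernoulli i : ZMod p) * ((q + 1).choose i) *
        (n : ZMod p) ^ (q + 1 - i) := by
  have h : ((q + 1 : ℕ) : ℚ) * ∑ k ∈ range n, (k : ℚ) ^ q =
      ∑ i ∈ range (q + 1), bernoulli i * ((q + 1).choose i : ℚ) * (n : ℚ) ^ (q + 1 - i) := by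
    rw [sum_range_pow, ← sum_div, mul_div_assoc']
    push_cast
    exact mul_div_cancel_left₀ _ (by positivity)
  have h₁ := (HasResidue.natCast (p := p) (q + 1)).mul
    (HasResidue.sum (s := range n) fun k _ => (HasResidue.natCast k).pow q)
  have h₂ := HasResidue.sum (s := range (q + 1)) fun i hi =>
    ((hasResidue_bernoulli (p := p) (i := i) (by have := mem_range.1 hi; omega)).mul
      (HasResidue.natCast ((q + 1).choose i))).mul ((HasResidue.natCast n).pow (q + 1 - i))
  rw [h] at h₁
  have := h₁.2.symm.trans h₂.2
  push_cast at this
  exact this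

theorem sum_range_eq_sum_univ (f : ZMod p → ZMod p) :
    ∑ k ∈ range p, f k = ∑ x : ZMod p, f x :=
  sum_nbij' (fun k => (k : ZMod p)) ZMod.val (by simp)
    (fun x _ => mem_range.2 (ZMod.val_lt x))
    (fun k hk => ZMod.val_cast_of_lt (mem_range.1 hk)) (fun x _ => ZMod.natCast_zmod_val x)
    (fun _ _ => rfl)

theorem sum_range_pow_eq_zero {i : ℕ} (hi : i < p - 1) : ∑ k ∈ range p, (k : ZMod p) ^ i = 0 := by
  rw [sum_range_eq_sum_univ (fun x => x ^ i)]
  exact FiniteField.sum_pow_lt_card_sub_one _ i (by rwa [ZMod.card])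

theorem nestedSum_singleton_eq_sum {a : ℕ} (ha : a ≠ 0) (n : ℕ) :
    nestedSum p [a] n = ∑ k ∈ range n, ((k : ZMod p) ^ a)⁻¹ := by
  rw [nestedSum_cons]
  refine sum_congr rfl fun k _ => ?_
  rcases eq_or_ne k 0 with rfl | hk
  · simp [ha]
  · rw [nestedSum_nil p hk, mul_one]

/-- Sums of depth one vanish modulo `p`. -/
theorem nestedSum_singleton {a : ℕ} (ha : a ≠ 0) (hp : a + 1 < p) : nestedSum p [a] p = 0 := by
  rw [nestedSum_singleton_eq_sum ha, sum_range_eq_sum_univ (fun x => (x ^ a)⁻¹),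
    ← sum_range_pow_eq_zero (p := p) (i := a) (by omega), sum_range_eq_sum_univ (fun x => x ^ a)]
  -- Inversion permutes `ZMod p` (fixing 0), so negative and positive power sums agree.
  exact Fintype.sum_equiv (Equiv.inv _) _ _ fun x => by simp

theorem inv_pow_eq_pow {b q : ℕ} (hb : b ≠ 0) (h : q + b + 1 = p) (hq : q ≠ 0) (x : ZMod p) :
    (x ^ b)⁻¹ = x ^ q := by
  rcases eq_or_ne x 0 with rfl | hx
  · simp [hb, hq]
  · refine inv_eq_of_mul_eq_one_right ?_
    rw [← pow_add]
    have := ZMod.pow_card_sub_one_eq_one hx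
    rwa [show b + q = p - 1 by omega]

theorem sum_range_inv_mul_pow {j : ℕ} (hj : j < p - 1) :
    ∑ k ∈ range p, (k : ZMod p)⁻¹ * (k : ZMod p) ^ (j + 1) = if j = 0 then -1 else 0 := by
  split_ifs with h
  · subst h
    -- The summand is 1 except at k = 0, where it is 0. Adding the missing 1 gives p = 0, hence the
    -- value -1.
    have h₁ : ∑ k ∈ range p, ((k : ZMod p)⁻¹ * (k : ZMod p) ^ (0 + 1) +
        if k = 0 then 1 else 0) = ∑ k ∈ range p, (k : ZMod p) ^ 0 := by
      refine sum_congr rfl fun k hk => ?_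
      split_ifs with hk0
      · simp [hk0]
      · rw [zero_add, pow_one, inv_mul_cancel₀ (natCast_ne_zero_of_lt p hk0 (mem_range.1 hk))]
        simp
    rw [sum_range_pow_eq_zero hj, sum_add_distrib, sum_ite_eq' (range p) 0 (fun _ => (1 : ZMod p)),
      if_pos (mem_range.2 (Fact.out : p.Prime).pos)] at h₁
    exact eq_neg_of_add_eq_zero_left h₁
  · rw [← sum_range_pow_eq_zero hj]
    refine sum_congr rfl fun k hk => ?_
    rcases eq_or_ne k 0 with rfl | hk0
    · simp [h]
    · rw [pow_succ', inv_mul_cancel_left₀ (natCast_ne_zero_of_lt p hk0 (mem_range.1 hk))]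

/-- The value of a double harmonic sum of index `(1, b)` modulo `p`. -/
theorem nestedSum_one_left {b q : ℕ} (hb : b ≠ 0) (hq : q ≠ 0) (h : q + b + 1 = p) :
    nestedSum p [1, b] p = -(bernoulli q : ZMod p) := by
  have hq1 : ((q : ZMod p) + 1) ≠ 0 := by
    exact_mod_cast natCast_ne_zero_of_lt p (n := q + 1) (by omega) (by omega)
  have hin : ∀ n, nestedSum p [b] n = ∑ k ∈ range n, (k : ZMod p) ^ q := by
    intro n
    rw [nestedSum_singleton_eq_sum hb]
    exact sum_congr rfl fun k _ => inv_pow_eq_pow hb h hq _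
  refine mul_left_cancel₀ hq1 ?_
  calc ((q : ZMod p) + 1) * nestedSum p [1, b] p
      = ∑ n ∈ range p, (n : ZMod p)⁻¹ *
          (((q : ZMod p) + 1) * ∑ k ∈ range n, (k : ZMod p) ^ q) := by
        rw [nestedSum_cons, mul_sum]
        refine sum_congr rfl fun n _ => ?_
        rw [hin, pow_one]
        ring
    _ = ∑ i ∈ range (q + 1), (bernoulli i : ZMod p) * ((q + 1).choose i) *
          ∑ n ∈ range p, (n : ZMod p)⁻¹ * (n : ZMod p) ^ (q - i + 1) := by
        simp only [mul_sum (range p)]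
        rw [sum_comm]
        refine sum_congr rfl fun n _ => ?_
        rw [sum_range_pow_zmod (by omega), mul_sum]
        refine sum_congr rfl fun i hi => ?_
        rw [show q + 1 - i = q - i + 1 by have := mem_range.1 hi; omega]
        ring
    -- The inner sum is a power sum of exponent q - i < p - 1; it vanishes unless i = q, where it is
    -- -1 and the binomial coefficient is q + 1.
    _ = ((q : ZMod p) + 1) * -(bernoulli q : ZMod p) := by
        rw [sum_range_succ, sum_eq_zero, sum_range_inv_mul_pow (by omega)]
        · simp
          ring
        · intro i hi
          have := mem_range.1 hi
          rw [sum_range_inv_mul_pow (by omega), if_neg (by omega), mul_zero]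

end Bernoulli

/-! ### From sums over tuples to nested sums, and the expansion of star sums. -/

section Index

/-- A sum over strictly decreasing tuples, organised by the largest entry. -/
theorem sum_strictAnti_cons {M : Type*} [AddCommMonoid M] {d : ℕ} (N : ℕ)
    (F : (Fin (d + 1) → ℕ) → M) :
    ∑ k ∈ (Fintype.piFinset fun _ : Fin (d + 1) => Ico 1 N) with ∀ i j, i < j → k j < k i, F k =
      ∑ m ∈ Ico 1 N, ∑ k ∈ (Fintype.piFinset fun _ : Fin d => Ico 1 m) with
        ∀ i j, i < j → k j < k i, F (Fin.cons m k) := by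
  rw [sum_sigma']
  refine sum_bij' (fun k _ => ⟨k 0, Fin.tail k⟩) (fun x _ => Fin.cons x.1 x.2) ?_ ?_ ?_ ?_ ?_
  · intro k hk
    simp only [mem_filter, Fintype.mem_piFinset, mem_Ico, mem_sigma, Fin.tail] at hk ⊢
    exact ⟨hk.1 0, fun i => ⟨(hk.1 _).1, hk.2 _ _ (Fin.succ_pos i)⟩,
      fun i j hij => hk.2 _ _ (Fin.succ_lt_succ_iff.2 hij)⟩
  · rintro ⟨m, k⟩ hk
    simp only [mem_filter, Fintype.mem_piFinset, mem_Ico, mem_sigma, Fin.forall_fin_succ,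
      Fin.cons_zero, Fin.cons_succ, Fin.succ_lt_succ_iff, lt_irrefl, Fin.not_lt_zero,
      Fin.succ_pos] at hk ⊢
    refine ⟨⟨hk.1, fun i => ⟨(hk.2.1 i).1, (hk.2.1 i).2.trans hk.1.2⟩⟩, ?_, ?_⟩
    · exact ⟨fun h => h.elim, fun i _ => (hk.2.1 i).2⟩
    · exact fun i => ⟨fun h => h.elim, fun j => hk.2.2 i j⟩
  · intro k _
    exact Fin.cons_self_tail k
  · rintro ⟨m, k⟩ _
    simp
  · intro k _
    simp

/-- A sum over weakly decreasing tuples, organised by the largest entry. -/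
theorem sum_antitone_cons {M : Type*} [AddCommMonoid M] {d : ℕ} (N : ℕ)
    (F : (Fin (d + 1) → ℕ) → M) :
    ∑ k ∈ (Fintype.piFinset fun _ : Fin (d + 1) => Ico 1 N) with ∀ i j, i < j → k j ≤ k i, F k =
      ∑ m ∈ Ico 1 N, ∑ k ∈ (Fintype.piFinset fun _ : Fin d => Ico 1 (m + 1)) with
        ∀ i j, i < j → k j ≤ k i, F (Fin.cons m k) := by
  rw [sum_sigma']
  refine sum_bij' (fun k _ => ⟨k 0, Fin.tail k⟩) (fun x _ => Fin.cons x.1 x.2) ?_ ?_ ?_ ?_ ?_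
  · intro k hk
    simp only [mem_filter, Fintype.mem_piFinset, mem_Ico, mem_sigma, Fin.tail] at hk ⊢
    exact ⟨hk.1 0, fun i => ⟨(hk.1 _).1, Nat.lt_succ_of_le (hk.2 _ _ (Fin.succ_pos i))⟩,
      fun i j hij => hk.2 _ _ (Fin.succ_lt_succ_iff.2 hij)⟩
  · rintro ⟨m, k⟩ hk
    simp only [mem_filter, Fintype.mem_piFinset, mem_Ico, mem_sigma, Fin.forall_fin_succ,
      Fin.cons_zero, Fin.cons_succ, Fin.succ_lt_succ_iff, Fin.not_lt_zero,
      Fin.succ_pos] at hk ⊢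
    refine ⟨⟨hk.1, fun i => ⟨(hk.2.1 i).1, ?_⟩⟩, ?_, ?_⟩
    · have := (hk.2.1 i).2
      omega
    · exact ⟨fun h => h.elim, fun i _ => Nat.le_of_lt_succ (hk.2.1 i).2⟩
    · exact fun i => ⟨fun h => h.elim, fun j => hk.2.2 i j⟩
  · intro k _
    exact Fin.cons_self_tail k
  · rintro ⟨m, k⟩ _
    simp
  · intro k _
    simp

variable (p : ℕ) [Fact p.Prime]

theorem sum_range_eq_sum_Ico {f : ℕ → ZMod p} (h : f 0 = 0) (n : ℕ) :
    ∑ k ∈ range n, f k = ∑ k ∈ Ico 1 n, f k := by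
  rcases n with _ | n
  · simp
  · rw [range_eq_Ico, sum_eq_sum_Ico_succ_bot (Nat.succ_pos n), h, zero_add]

/-- For d = 0 the tuple sum is 1 for every N, whereas `nestedSum p [] 0 = 0`; hence N ≠ 0. -/
theorem nestedSum_ofFn {d : ℕ} (s : Fin d → ℕ) {N : ℕ} (hN : N ≠ 0) :
    ∑ k ∈ (Fintype.piFinset fun _ : Fin d => Ico 1 N) with ∀ i j : Fin d, i < j → k j < k i,
      ∏ j : Fin d, ((k j : ZMod p) ^ s j)⁻¹ = nestedSum p (List.ofFn s) N := by
  induction d generalizing N with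
  | zero => simp [nestedSum_nil p hN]
  | succ d ih =>
    rw [sum_strictAnti_cons, List.ofFn_succ, nestedSum_cons, sum_range_eq_sum_Ico p (by simp)]
    refine sum_congr rfl fun m hm => ?_
    rw [← ih _ (by have := mem_Ico.1 hm; omega), mul_sum]
    refine sum_congr rfl fun k _ => ?_
    rw [Fin.prod_univ_succ]
    simp

/-- The indices obtained from `s` by adding up consecutive entries. -/
def mergings : List ℕ → List (List ℕ)
  | [] => [[]]
  | [a] => [[a]]
  | a :: b :: s => (mergings (b :: s)).map (a :: ·) ++ mergings ((a + b) :: s)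
  termination_by s => s.length

/-- The sum `∑_{n > k₁ ≥ ⋯ ≥ k_d ≥ 1} 1 / (k₁^{s₁} ⋯ k_d^{s_d})` modulo `p`. -/
def nestedSumStar : List ℕ → ℕ → ZMod p
  | [], _ => 1
  | a :: s, n => ∑ k ∈ Ico 1 n, ((k : ZMod p) ^ a)⁻¹ * nestedSumStar s (k + 1)

theorem nestedSumStar_ofFn {d : ℕ} (s : Fin d → ℕ) (N : ℕ) :
    ∑ k ∈ (Fintype.piFinset fun _ : Fin d => Ico 1 N) with ∀ i j : Fin d, i < j → k j ≤ k i,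
      ∏ j : Fin d, ((k j : ZMod p) ^ s j)⁻¹ = nestedSumStar p (List.ofFn s) N := by
  induction d generalizing N with
  | zero => simp [nestedSumStar]
  | succ d ih =>
    rw [sum_antitone_cons, List.ofFn_succ, nestedSumStar]
    refine sum_congr rfl fun m _ => ?_
    rw [← ih, mul_sum]
    refine sum_congr rfl fun k _ => ?_
    rw [Fin.prod_univ_succ]
    simp

/-- Splits the sum according to whether the two largest entries differ or coincide. -/
theorem nestedSumStar_cons_cons (a b : ℕ) (s : List ℕ) (n : ℕ) :
    nestedSumStar p (a :: b :: s) n =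
      ∑ k ∈ Ico 1 n, ((k : ZMod p) ^ a)⁻¹ * nestedSumStar p (b :: s) k +
        nestedSumStar p ((a + b) :: s) n := by
  rw [nestedSumStar, nestedSumStar, ← sum_add_distrib]
  refine sum_congr rfl fun k hk => ?_
  rw [nestedSumStar, nestedSumStar, sum_Ico_succ_top (mem_Ico.1 hk).1, pow_add, mul_inv]
  ring

theorem nestedSumStar_eq_sum_mergings (s : List ℕ) {n : ℕ} (hn : n ≠ 0) :
    nestedSumStar p s n = ((mergings s).map (nestedSum p · n)).sum := by
  induction s using mergings.induct generalizing n with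
  | case1 => simp [mergings, nestedSumStar, nestedSum_nil p hn]
  | case2 a =>
    simp only [mergings, nestedSumStar, List.map_cons, List.map_nil, List.sum_singleton,
      nestedSum_cons]
    rw [sum_range_eq_sum_Ico p (by simp)]
    refine sum_congr rfl fun k hk => ?_
    rw [nestedSum_nil p (by have := mem_Ico.1 hk; omega)]
  | case3 a b s ih₁ ih₂ =>
    rw [mergings, List.map_append, List.sum_append, nestedSum_sum_cons, nestedSumStar_cons_cons,
      ih₂ hn, sum_range_eq_sum_Ico p (by simp)]
    congr 1
    refine sum_congr rfl fun k hk => ?_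
    rw [ih₁ (by have := mem_Ico.1 hk; omega)]

end Index

/-! ### The relations in 𝒜₁. -/

section Relations

/-- The finite multiple zeta value of an index given as a list. -/
noncomputable def zetaList (s : List ℕ) : A₁ := mk fun p => nestedSum p s p

theorem zeta_eq_zetaList {d : ℕ} (s : Fin d → ℕ) : zeta s = zetaList (List.ofFn s) := by
  refine congrArg mk (funext fun p => ?_)
  have : Fact (p : ℕ).Prime := ⟨p.2⟩
  exact nestedSum_ofFn p s p.2.ne_zero

theorem mk_list_sum (L : List (List ℕ)) :
    mk (fun p => (L.map fun s => nestedSum p s p).sum) = (L.map zetaList).sum := by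
  induction L with
  | nil => exact map_zero mk
  | cons s L ih =>
    rw [List.map_cons, List.sum_cons, ← ih, zetaList, ← map_add]
    rfl

theorem zetaStar_eq_sum_mergings {d : ℕ} (s : Fin d → ℕ) :
    zetaStar s = ((mergings (List.ofFn s)).map zetaList).sum := by
  rw [← mk_list_sum]
  refine congrArg mk (funext fun p => ?_)
  have : Fact (p : ℕ).Prime := ⟨p.2⟩
  exact (nestedSumStar_ofFn p s p).trans (nestedSumStar_eq_sum_mergings p _ p.2.ne_zero)

/-- Families that agree at all primes `p > N` have the same class. -/
theorem mk_congr_of_lt {a b : ∀ p : Nat.Primes, ZMod p} (N : ℕ)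
    (h : ∀ p : Nat.Primes, N < p → a p = b p) : mk a = mk b := by
  rw [mk_eq_mk_iff]
  refine Set.Finite.of_finite_image (f := fun p : Nat.Primes => (p : ℕ))
    ((Set.finite_Iic N).subset ?_) Nat.Primes.coe_nat_injective.injOn
  rintro _ ⟨p, hp, rfl⟩
  exact not_lt.1 fun hlt => hp (h p hlt)

theorem zetaList_singleton {a : ℕ} (ha : a ≠ 0) : zetaList [a] = 0 := by
  rw [← map_zero mk]
  refine mk_congr_of_lt (a + 1) fun p hp => ?_
  have : Fact (p : ℕ).Prime := ⟨p.2⟩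
  exact nestedSum_singleton ha hp

/-- The reversal relation. -/
theorem zetaList_reverse (s : List ℕ) : zetaList s = (-1) ^ s.sum * zetaList s.reverse := by
  rw [zetaList, zetaList, ← map_one mk, ← map_neg, ← map_pow, ← map_mul]
  refine congrArg mk (funext fun p => ?_)
  have : Fact (p : ℕ).Prime := ⟨p.2⟩
  exact nestedSum_reverse p s

/-- The quasi-shuffle relation with the value of depth one, which vanishes. -/
theorem sum_stuffleInsert {a : ℕ} (ha : a ≠ 0) (s : List ℕ) :
    ((stuffleInsert a s).map zetaList).sum = 0 := by
  rw [← mk_list_sum, ← zero_mul (zetaList s), ← zetaList_singleton ha, zetaList, zetaList,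
    ← map_mul]
  refine congrArg mk (funext fun p => ?_)
  have : Fact (p : ℕ).Prime := ⟨p.2⟩
  exact (nestedSum_singleton_mul p a s p).symm

/-- The shuffle relation. -/
theorem sum_shuffle {s t : List ℕ} (hs : ∀ a ∈ s, 1 ≤ a) (ht : ∀ a ∈ t, 1 ≤ a) :
    (((shuffle (indexWord s) (indexWord t)).map wordIndex).map zetaList).sum =
      (-1) ^ t.sum * zetaList (t.reverse ++ s) := by
  rw [← mk_list_sum, zetaList, ← map_one mk, ← map_neg, ← map_pow, ← map_mul]
  refine congrArg mk (funext fun p => ?_)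
  have : Fact (p : ℕ).Prime := ⟨p.2⟩
  rw [List.map_map]
  exact sum_shuffle_nestedSum p hs ht

/-- The value of index `(1, c - 1)` is `-c` times the Bernoulli number `b c` of `𝒜₁`. -/
theorem zetaList_one_left {c : ℕ} (hc : 2 ≤ c) : zetaList [1, c - 1] = -(c * b c) := by
  rw [b, ← map_natCast mk, ← map_mul, ← map_neg]
  refine mk_congr_of_lt c fun p hp => ?_
  have : Fact (p : ℕ).Prime := ⟨p.2⟩
  have hc0 : (c : ZMod p) ≠ 0 := natCast_ne_zero_of_lt p (by omega) hp
  have hB := hasResidue_bernoulli (p := p) (i := p - c) (by omega)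
  have := (hB.mul (HasResidue.natCast_inv hc0)).2
  rw [← div_eq_mul_inv] at this
  rw [nestedSum_one_left (q := p - c) (by omega) (by omega) (by omega)]
  simp only [Pi.neg_apply, Pi.mul_apply, Pi.natCast_apply, if_pos hp, ratMod_eq_cast]
  rw [this]
  field_simp

end Relations

/-! ### Solving the linear systems in weight 7. -/

section WeightSeven

/-- 𝒜₁ is not a domain, but nonzero integers are units because it is a ℚ-algebra. This clears
denominators in the linear algebra below. -/
theorem eq_of_natCast_mul {n : ℕ} (hn : n ≠ 0) {x y : A₁} (h : (n : A₁) * x = n * y) : x = y := by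
  have hu : IsUnit (n : A₁) := by
    simpa using (IsUnit.mk0 (n : ℚ) (by exact_mod_cast hn)).map (algebraMap ℚ A₁)
  exact hu.mul_left_cancel h

theorem zetaList_reverse_of_odd {s : List ℕ} (hs : Odd s.sum) :
    zetaList s.reverse = -zetaList s := by
  rw [zetaList_reverse s, hs.neg_one_pow, neg_one_mul, neg_neg]

theorem zetaList_eq_zero_of_palindrome {s : List ℕ} (hs : Odd s.sum) (h : s.reverse = s) :
    zetaList s = 0 := by
  have hr := zetaList_reverse_of_odd hs
  rw [h] at hr
  refine eq_of_natCast_mul (n := 2) (by decide) ?_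
  push_cast
  linear_combination hr

/-- The values of weight seven and depth two or three. -/
theorem zetaList_depth_two_three {u : A₁} (hu : zetaList [1, 6] = -16 * u) :
    zetaList [1, 6] = -16 * u ∧
    zetaList [2, 5] = 48 * u ∧
    zetaList [3, 4] = -80 * u ∧
    zetaList [4, 3] = 80 * u ∧
    zetaList [5, 2] = -48 * u ∧
    zetaList [6, 1] = 16 * u ∧
    zetaList [1, 1, 5] = -16 * u ∧
    zetaList [1, 2, 4] = 48 * u ∧
    zetaList [1, 3, 3] = -32 * u ∧
    zetaList [1, 4, 2] = 32 * u ∧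
    zetaList [1, 5, 1] = 0 ∧
    zetaList [2, 1, 4] = 16 * u ∧
    zetaList [2, 2, 3] = -64 * u ∧
    zetaList [2, 3, 2] = 0 ∧
    zetaList [2, 4, 1] = -32 * u ∧
    zetaList [3, 1, 3] = 0 ∧
    zetaList [3, 2, 2] = 64 * u ∧
    zetaList [3, 3, 1] = 32 * u ∧
    zetaList [4, 1, 2] = -16 * u ∧
    zetaList [4, 2, 1] = -48 * u ∧
    zetaList [5, 1, 1] = 16 * u := by
  have r₁ : zetaList [6, 1] = -zetaList [1, 6] :=
    zetaList_reverse_of_odd (s := [1, 6]) (by decide)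
  have r₂ : zetaList [5, 2] = -zetaList [2, 5] :=
    zetaList_reverse_of_odd (s := [2, 5]) (by decide)
  have r₃ : zetaList [4, 3] = -zetaList [3, 4] :=
    zetaList_reverse_of_odd (s := [3, 4]) (by decide)
  have r₄ : zetaList [5, 1, 1] = -zetaList [1, 1, 5] :=
    zetaList_reverse_of_odd (s := [1, 1, 5]) (by decide)
  have r₅ : zetaList [4, 2, 1] = -zetaList [1, 2, 4] :=
    zetaList_reverse_of_odd (s := [1, 2, 4]) (by decide)
  have r₆ : zetaList [3, 3, 1] = -zetaList [1, 3, 3] :=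
    zetaList_reverse_of_odd (s := [1, 3, 3]) (by decide)
  have r₇ : zetaList [2, 4, 1] = -zetaList [1, 4, 2] :=
    zetaList_reverse_of_odd (s := [1, 4, 2]) (by decide)
  have r₈ : zetaList [4, 1, 2] = -zetaList [2, 1, 4] :=
    zetaList_reverse_of_odd (s := [2, 1, 4]) (by decide)
  have r₉ : zetaList [3, 2, 2] = -zetaList [2, 2, 3] :=
    zetaList_reverse_of_odd (s := [2, 2, 3]) (by decide)
  have q₁ : zetaList [1, 5, 1] = 0 := zetaList_eq_zero_of_palindrome (by decide) rfl
  have q₂ : zetaList [2, 3, 2] = 0 := zetaList_eq_zero_of_palindrome (by decide) rfl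
  have q₃ : zetaList [3, 1, 3] = 0 := zetaList_eq_zero_of_palindrome (by decide) rfl
  -- Up to reversal and palindromes there are eight unknowns: two of depth 2 and six of depth 3.
  -- These eight relations determine them.
  have e₁ := sum_shuffle (s := [2, 3]) (t := [2]) (by decide) (by decide)
  have e₂ := sum_stuffleInsert (a := 2) (by decide) [2, 3]
  have e₃ := sum_shuffle (s := [4]) (t := [3]) (by decide) (by decide)
  have e₄ := sum_stuffleInsert (a := 3) (by decide) [1, 3]
  have e₅ := sum_stuffleInsert (a := 1) (by decide) [2, 4]
  have e₆ := sum_stuffleInsert (a := 2) (by decide) [1, 4]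
  have e₇ := sum_stuffleInsert (a := 1) (by decide) [1, 5]
  have e₈ := sum_stuffleInsert (a := 4) (by decide) [1, 2]
  simp [stuffleInsert, shuffle, indexWord, wordIndex, List.replicate_succ,
    hu, r₁, r₂, r₃, r₆, r₇, r₈, r₉, q₁, q₂, q₃]
    at e₁ e₂ e₃ e₄ e₅ e₆ e₇ e₈
  -- The coefficients come from inverting the system, with n as common denominator.
  have v₁ : zetaList [2, 5] = 48 * u :=
    eq_of_natCast_mul (n := 40) (by decide) (by
      push_cast
      linear_combination 4 * e₁ + 2 * e₂ - 5 * e₃ + 8 * e₄ - 12 * e₅ + 12 * e₆)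
  have v₂ : zetaList [3, 4] = -80 * u :=
    eq_of_natCast_mul (n := 8) (by decide) (by
      push_cast
      linear_combination -4 * e₁ - 2 * e₂ + e₃ - 8 * e₄ + 12 * e₅ - 12 * e₆)
  have v₃ : zetaList [1, 1, 5] = -16 * u :=
    eq_of_natCast_mul (n := 80) (by decide) (by
      push_cast
      linear_combination -4 * e₁ - 2 * e₂ + 5 * e₃ - 8 * e₄ + 12 * e₅ - 12 * e₆ + 40 * e₇)
  have v₄ : zetaList [1, 2, 4] = 48 * u :=
    eq_of_natCast_mul (n := 16) (by decide) (by
      push_cast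
      linear_combination 4 * e₁ + 2 * e₂ - e₃ + 8 * e₄ - 4 * e₅ + 12 * e₆ + 8 * e₈)
  have v₅ : zetaList [1, 3, 3] = -32 * u :=
    eq_of_natCast_mul (n := 16) (by decide) (by
      push_cast
      linear_combination -4 * e₁ - 2 * e₂ + e₃ + 12 * e₅ - 12 * e₆)
  have v₆ : zetaList [1, 4, 2] = 32 * u :=
    eq_of_natCast_mul (n := 80) (by decide) (by
      push_cast
      linear_combination 4 * e₁ + 2 * e₂ - 5 * e₃ + 8 * e₄ - 52 * e₅ + 52 * e₆)
  have v₇ : zetaList [2, 1, 4] = 16 * u :=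
    eq_of_natCast_mul (n := 10) (by decide) (by
      push_cast
      linear_combination 2 * e₁ + e₂ + 4 * e₄ - 6 * e₅ + 11 * e₆ - 5 * e₈)
  have v₈ : zetaList [2, 2, 3] = -64 * u :=
    eq_of_natCast_mul (n := 40) (by decide) (by
      push_cast
      linear_combination -12 * e₁ + 14 * e₂ + 5 * e₃ - 24 * e₄ + 36 * e₅ - 36 * e₆)
  exact ⟨hu, v₁, v₂, by linear_combination r₃ - v₂, by linear_combination r₂ - v₁, by
    linear_combination r₁ - hu, v₃, v₄, v₅, v₆, q₁, v₇, v₈, q₂, by linear_combination r₇ - v₆,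
    q₃, by linear_combination r₉ - v₈, by linear_combination r₆ - v₅, by linear_combination r₈ -
    v₇, by linear_combination r₅ - v₄, by linear_combination r₄ - v₃⟩

/-- The values of weight seven and depth four. -/
theorem zetaList_depth_four {u : A₁} (hu : zetaList [1, 6] = -16 * u) :
    zetaList [1, 1, 1, 4] = -27 * u ∧
    zetaList [1, 1, 2, 3] = 69 * u ∧
    zetaList [1, 1, 3, 2] = -27 * u ∧
    zetaList [1, 1, 4, 1] = 33 * u ∧
    zetaList [1, 2, 1, 3] = -27 * u ∧
    zetaList [1, 2, 2, 2] = -27 * u ∧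
    zetaList [1, 2, 3, 1] = -63 * u ∧
    zetaList [1, 3, 1, 2] = -9 * u ∧
    zetaList [1, 3, 2, 1] = 63 * u ∧
    zetaList [1, 4, 1, 1] = -33 * u ∧
    zetaList [2, 1, 1, 3] = 33 * u ∧
    zetaList [2, 1, 2, 2] = -63 * u ∧
    zetaList [2, 1, 3, 1] = 9 * u ∧
    zetaList [2, 2, 1, 2] = 63 * u ∧
    zetaList [2, 2, 2, 1] = 27 * u ∧
    zetaList [2, 3, 1, 1] = 27 * u ∧
    zetaList [3, 1, 1, 2] = -33 * u ∧
    zetaList [3, 1, 2, 1] = 27 * u ∧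
    zetaList [3, 2, 1, 1] = -69 * u ∧
    zetaList [4, 1, 1, 1] = 27 * u := by
  have hlow := zetaList_depth_two_three hu
  have r₁ : zetaList [4, 1, 1, 1] = -zetaList [1, 1, 1, 4] :=
    zetaList_reverse_of_odd (s := [1, 1, 1, 4]) (by decide)
  have r₂ : zetaList [3, 2, 1, 1] = -zetaList [1, 1, 2, 3] :=
    zetaList_reverse_of_odd (s := [1, 1, 2, 3]) (by decide)
  have r₃ : zetaList [2, 3, 1, 1] = -zetaList [1, 1, 3, 2] :=
    zetaList_reverse_of_odd (s := [1, 1, 3, 2]) (by decide)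
  have r₄ : zetaList [1, 4, 1, 1] = -zetaList [1, 1, 4, 1] :=
    zetaList_reverse_of_odd (s := [1, 1, 4, 1]) (by decide)
  have r₅ : zetaList [3, 1, 2, 1] = -zetaList [1, 2, 1, 3] :=
    zetaList_reverse_of_odd (s := [1, 2, 1, 3]) (by decide)
  have r₆ : zetaList [2, 2, 2, 1] = -zetaList [1, 2, 2, 2] :=
    zetaList_reverse_of_odd (s := [1, 2, 2, 2]) (by decide)
  have r₇ : zetaList [1, 3, 2, 1] = -zetaList [1, 2, 3, 1] :=
    zetaList_reverse_of_odd (s := [1, 2, 3, 1]) (by decide)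
  have r₈ : zetaList [2, 1, 3, 1] = -zetaList [1, 3, 1, 2] :=
    zetaList_reverse_of_odd (s := [1, 3, 1, 2]) (by decide)
  have r₉ : zetaList [3, 1, 1, 2] = -zetaList [2, 1, 1, 3] :=
    zetaList_reverse_of_odd (s := [2, 1, 1, 3]) (by decide)
  have r₁₀ : zetaList [2, 2, 1, 2] = -zetaList [2, 1, 2, 2] :=
    zetaList_reverse_of_odd (s := [2, 1, 2, 2]) (by decide)
  -- The twenty indices form ten reversal pairs, and these ten relations determine one value in each
  -- pair; terms of lower depth are already known.
  have e₁ := sum_shuffle (s := [2, 1, 3]) (t := [1]) (by decide) (by decide)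
  have e₂ := sum_shuffle (s := [1, 1, 4]) (t := [1]) (by decide) (by decide)
  have e₃ := sum_stuffleInsert (a := 1) (by decide) [1, 1, 4]
  have e₄ := sum_shuffle (s := [1, 3, 2]) (t := [1]) (by decide) (by decide)
  have e₅ := sum_stuffleInsert (a := 2) (by decide) [1, 2, 2]
  have e₆ := sum_shuffle (s := [1, 2, 2]) (t := [2]) (by decide) (by decide)
  have e₇ := sum_shuffle (s := [1, 2, 3]) (t := [1]) (by decide) (by decide)
  have e₈ := sum_stuffleInsert (a := 1) (by decide) [1, 2, 3]
  have e₉ := sum_stuffleInsert (a := 1) (by decide) [1, 3, 2]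
  have e₁₀ := sum_stuffleInsert (a := 1) (by decide) [2, 1, 3]
  simp [stuffleInsert, shuffle, indexWord, wordIndex, List.replicate_succ,
    hlow, r₆, r₇, r₈, r₁₀]
    at e₁ e₂ e₃ e₄ e₅ e₆ e₇ e₈ e₉ e₁₀
  have v₁ : zetaList [1, 1, 1, 4] = -27 * u :=
    eq_of_natCast_mul (n := 16) (by decide) (by
      push_cast
      linear_combination -4 * e₁ - 8 * e₂ + 16 * e₃ - 4 * e₄ + 3 * e₅ - e₆ - 4 * e₇ + 10 * e₈
        + 10 * e₉ + 6 * e₁₀)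
  have v₂ : zetaList [1, 1, 2, 3] = 69 * u :=
    eq_of_natCast_mul (n := 16) (by decide) (by
      push_cast
      linear_combination -4 * e₁ + 4 * e₄ + 3 * e₅ - e₆ - 12 * e₇ + 26 * e₈ - 6 * e₉ + 6 *
        e₁₀)
  have v₃ : zetaList [1, 1, 3, 2] = -27 * u :=
    eq_of_natCast_mul (n := 16) (by decide) (by
      push_cast
      linear_combination -4 * e₁ - 12 * e₄ + 3 * e₅ - e₆ + 4 * e₇ - 6 * e₈ + 26 * e₉ + 6 *
        e₁₀)
  have v₄ : zetaList [1, 1, 4, 1] = 33 * u :=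
    eq_of_natCast_mul (n := 16) (by decide) (by
      push_cast
      linear_combination 12 * e₁ + 24 * e₂ - 32 * e₃ + 12 * e₄ - 9 * e₅ + 3 * e₆ + 12 * e₇ -
        30 * e₈ - 30 * e₉ - 18 * e₁₀)
  have v₅ : zetaList [1, 2, 1, 3] = -27 * u :=
    eq_of_natCast_mul (n := 16) (by decide) (by
      push_cast
      linear_combination 12 * e₁ + 20 * e₄ - 13 * e₅ - e₆ + 20 * e₇ - 30 * e₈ - 30 * e₉ - 18 *
        e₁₀)
  have v₆ : zetaList [1, 2, 2, 2] = -27 * u :=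
    eq_of_natCast_mul (n := 16) (by decide) (by
      push_cast
      linear_combination -4 * e₁ + 4 * e₄ + 3 * e₅ - e₆ + 4 * e₇ - 6 * e₈ - 6 * e₉ + 6 * e₁₀)
  have v₇ : zetaList [1, 2, 3, 1] = -63 * u :=
    eq_of_natCast_mul (n := 16) (by decide) (by
      push_cast
      linear_combination -4 * e₁ - 28 * e₄ + 7 * e₅ + 3 * e₆ + 4 * e₇ - 6 * e₈ + 42 * e₉ + 6 *
        e₁₀)
  have v₈ : zetaList [1, 3, 1, 2] = -9 * u :=
    eq_of_natCast_mul (n := 16) (by decide) (by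
      push_cast
      linear_combination 4 * e₁ - 4 * e₄ + e₅ + 5 * e₆ - 4 * e₇ + 6 * e₈ + 6 * e₉ - 6 * e₁₀)
  have v₉ : zetaList [2, 1, 1, 3] = 33 * u :=
    eq_of_natCast_mul (n := 16) (by decide) (by
      push_cast
      linear_combination -4 * e₁ - 12 * e₄ + 7 * e₅ + 3 * e₆ - 12 * e₇ + 18 * e₈ + 18 * e₉ +
        14 * e₁₀)
  have v₁₀ : zetaList [2, 1, 2, 2] = -63 * u :=
    eq_of_natCast_mul (n := 16) (by decide) (by
      push_cast
      linear_combination 12 * e₁ - 12 * e₄ + 7 * e₅ + 3 * e₆ - 12 * e₇ + 18 * e₈ + 18 * e₉ -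
        18 * e₁₀)
  exact ⟨v₁, v₂, v₃, v₄, v₅, v₆, v₇, v₈, by linear_combination r₇ - v₇, by linear_combination r₄ -
    v₄, v₉, v₁₀, by linear_combination r₈ - v₈, by linear_combination r₁₀ - v₁₀, by
    linear_combination r₆ - v₆, by linear_combination r₃ - v₃, by linear_combination r₉ - v₉, by
    linear_combination r₅ - v₅, by linear_combination r₂ - v₂, by linear_combination r₁ - v₁⟩

/-- The unit of the table of values of weight seven: the class of `B_{p-7} / 16`. -/
noncomputable def bUnit : A₁ := (7 / 16 : ℚ) • b 7

theorem intCast_mul_bUnit (c : ℤ) : (c : A₁) * bUnit = ((c : ℚ) * (7 / 16)) • b 7 := by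
  rw [mul_smul, bUnit, Algebra.smul_def (c : ℚ), map_intCast]

theorem zetaList_one_six : zetaList [1, 6] = -16 * bUnit := by
  have h := intCast_mul_bUnit (-16)
  rw [show (((-16 : ℤ) : ℚ) * (7 / 16)) = ((-7 : ℤ) : ℚ) by norm_num, Algebra.smul_def,
    map_intCast] at h
  have h' := zetaList_one_left (c := 7) (by norm_num)
  push_cast at h h'
  linear_combination h' - h

theorem zeta_fin_four (a b c d : ℕ) : zeta ![a, b, c, d] = zetaList [a, b, c, d] := by
  rw [zeta_eq_zetaList]
  simp

theorem zetaStar_fin_four (a b c d : ℕ) :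
    zetaStar ![a, b, c, d] = ((mergings [a, b, c, d]).map zetaList).sum := by
  rw [zetaStar_eq_sum_mergings]
  simp

/-- Every coefficient in the depth-four table is, up to sign, a numeral at least 2, so these two
shapes cover all cases. -/
theorem exists_intCast_mul_bUnit (k : ℕ) [k.AtLeastTwo] :
    (∃ n : ℤ, (OfNat.ofNat k : A₁) * bUnit = n * bUnit) ∧
      ∃ n : ℤ, -(OfNat.ofNat k : A₁) * bUnit = n * bUnit :=
  ⟨⟨OfNat.ofNat k, by rw [Int.cast_ofNat]⟩, ⟨-OfNat.ofNat k, by rw [Int.cast_neg, Int.cast_ofNat]⟩⟩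

theorem exists_intCast_mul_bUnit_and_zetaStar_eq {a b c d : ℕ} (ha : 1 ≤ a) (hb : 1 ≤ b)
    (hc : 1 ≤ c) (hd : 1 ≤ d) (h : a + b + c + d = 7) :
    (∃ n : ℤ, zetaList [a, b, c, d] = n * bUnit) ∧
      zetaStar ![a, b, c, d] = zetaList [a, b, c, d] := by
  have h₃ := zetaList_depth_two_three zetaList_one_six
  have h₄ := zetaList_depth_four zetaList_one_six
  -- The last entry is eliminated, so only three entries are enumerated; triples leaving no positive
  -- last entry are contradictory.
  have hd' : d = 7 - a - b - c := by omega
  have : a ≤ 4 := by omega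
  have : b ≤ 4 := by omega
  have : c ≤ 4 := by omega
  rw [zetaStar_fin_four]
  subst hd'
  constructor
  · interval_cases a <;> interval_cases b <;> interval_cases c <;>
      first
        | omega
        | (simp only [h₄]
           first
             | exact (exists_intCast_mul_bUnit _).1
             | exact (exists_intCast_mul_bUnit _).2)
  · interval_cases a <;> interval_cases b <;> interval_cases c <;>
      first
        | omega
        | (simp [mergings, h₃, h₄, zetaList_singleton]
           ring)

end WeightSeven

end FMZV

theorem mainTheorem8 :
    -- the table of values; the unit is `7 b₇ / 16`, i.e. `B_{p-7} / 16`
    (FMZV.zeta ![1, 1, 1, 4] = (-27 * (7 / 16) : ℚ) • FMZV.b 7 ∧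
      FMZV.zeta ![1, 1, 2, 3] = (69 * (7 / 16) : ℚ) • FMZV.b 7 ∧
      FMZV.zeta ![1, 1, 3, 2] = (-27 * (7 / 16) : ℚ) • FMZV.b 7 ∧
      FMZV.zeta ![1, 1, 4, 1] = (33 * (7 / 16) : ℚ) • FMZV.b 7 ∧
      FMZV.zeta ![1, 2, 1, 3] = (-27 * (7 / 16) : ℚ) • FMZV.b 7 ∧
      FMZV.zeta ![1, 2, 2, 2] = (-27 * (7 / 16) : ℚ) • FMZV.b 7 ∧
      FMZV.zeta ![1, 2, 3, 1] = (-63 * (7 / 16) : ℚ) • FMZV.b 7 ∧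
      FMZV.zeta ![1, 3, 1, 2] = (-9 * (7 / 16) : ℚ) • FMZV.b 7 ∧
      FMZV.zeta ![2, 1, 1, 3] = (33 * (7 / 16) : ℚ) • FMZV.b 7 ∧
      FMZV.zeta ![2, 1, 2, 2] = (-63 * (7 / 16) : ℚ) • FMZV.b 7) ∧
    -- all values of depth 4 and weight 7
    ∀ s : Fin 4 → ℕ, (∀ i, 1 ≤ s i) → ∑ i, s i = 7 →
      FMZV.zeta (fun i => s (Fin.rev i)) = -FMZV.zeta s ∧
      (∃ r : ℚ, FMZV.zeta s = r • FMZV.b 7) ∧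
      FMZV.zetaStar s = FMZV.zeta s := by
  have h₄ := FMZV.zetaList_depth_four FMZV.zetaList_one_six
  have hval : ∀ {a b c d : ℕ} (n : ℤ) {r : ℚ}, r = n * (7 / 16) →
      FMZV.zetaList [a, b, c, d] = n * FMZV.bUnit → FMZV.zeta ![a, b, c, d] = r • FMZV.b 7 :=
    fun n _ hr h => by rw [hr, FMZV.zeta_fin_four, h, FMZV.intCast_mul_bUnit]
  refine ⟨⟨hval (-27) ?_ ?_, hval 69 ?_ ?_, hval (-27) ?_ ?_, hval 33 ?_ ?_, hval (-27) ?_ ?_,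
    hval (-27) ?_ ?_, hval (-63) ?_ ?_, hval (-9) ?_ ?_, hval 33 ?_ ?_, hval (-63) ?_ ?_⟩,
    fun s hs hsum => ?_⟩
  any_goals simp [h₄]
  · obtain ⟨a, b, c, d, rfl⟩ : ∃ a b c d, s = ![a, b, c, d] :=
      ⟨s 0, s 1, s 2, s 3, by funext i; fin_cases i <;> rfl⟩
    have hsum' : a + b + c + d = 7 := by simpa [Fin.sum_univ_four] using hsum
    obtain ⟨⟨n, hn⟩, hstar⟩ := FMZV.exists_intCast_mul_bUnit_and_zetaStar_eq (hs 0) (hs 1) (hs 2)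
      (hs 3) hsum'
    have hrev : (fun i => ![a, b, c, d] (Fin.rev i)) = ![d, c, b, a] := by
      funext i
      fin_cases i <;> rfl
    refine ⟨?_, ⟨_, hval n rfl hn⟩, ?_⟩
    · rw [hrev, FMZV.zeta_fin_four, FMZV.zeta_fin_four]
      refine FMZV.zetaList_reverse_of_odd (s := [a, b, c, d]) ?_
      rw [show [a, b, c, d].sum = 7 by simpa [add_assoc] using hsum']
      decide
    · rw [FMZV.zeta_fin_four]
      exact hstar
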